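/- All digraphs are finite and are orientations of simple graphs (no loops, no multiple arcs, no pair of opposite arcs); the chromatic number $\chi$ of a digraph is that of its underlying graph. For $k\ge 1$, let $C(k,1,1,1,1,1)$ be the oriented cycle formed of six blocks (maximal directed subpaths) of lengths $k,1,1,1,1,1$. A subdivision of a digraph $H$ is obtained by replacing each arc $(x,y)$ of $H$ by a directed path from $x$ to $y$ of length at least $1$, the new paths being internally disjoint. Let $D$ be a digraph that contains no subdivision of $C(k,1,1,1,1,1)$ as a subdigraph, and let $T$ be a spanning out-tree of $D$ with source $r$ (a spanning subdigraph whose underlying graph is a tree, in which every vertex has in-degree at most $1$ and $r$ has in-degree $0$). For a vertex $x$, let $l_T(x)$ be the number of vertices of the unique directed path of $T$ from $r$ to $x$, and write $y\leqslant_T x$ if $y$ lies on this path. Suppose that $T$ is final, that is, $y\leqslant_T x$ for every arc $(x,y)$ of $D$ with $l_T(x)\ge l_T(y)$. For $1\le i\le k$, let $D_i$ be the subdigraph of $D$ induced by $V_i=\{x : l_T(x)=i+\alpha k \text{ for some integer } \alpha\ge 0\}$, and let $D_i^3$ be the spanning subdigraph of $D_i$ whose arcs are the arcs $(x,y)$ of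 $D_i$ that satisfy neither ($l_T(x)<l_T(y)$ and $x\leqslant_T y$) nor ($l_T(x)>l_T(y)$ and $y\leqslant_T x$). Then $\chi(D_i^3)\le 24$ for all $i\in\{1,2,\dots,k\}$. -/

import Mathlib

namespace SixBlocks

/-- A digraph obtained by giving one orientation to each edge of a simple graph:
no loops and no pair of opposite arcs. -/
def IsOriented {V : Type*} (D : Digraph V) : Prop :=
  ∀ x y, D.Adj x y → ¬ D.Adj y x

/-- The chromatic number of a digraph is that of its underlying simple graph. -/
noncomputable def chi {V : Type*} (D : Digraph V) : ℕ∞ :=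
  D.toSimpleGraphInclusive.chromaticNumber

/-- `p` is the list of vertices of a directed path of `D` from `x` to `y`. -/
structure IsDipath {V : Type*} (D : Digraph V) (x y : V) (p : List V) : Prop where
  chain : p.IsChain D.Adj
  nodup : p.Nodup
  head : p.head? = some x
  last : p.getLast? = some y

/-- The internal vertices of a path given by its list of vertices. -/
def internalVertices {V : Type*} (p : List V) : List V := p.tail.dropLast

/-- `D` contains a subdivision of the loopless digraph `H`: `φ` places the vertices of `H`, and each
arc `(u, v)` of `H` is replaced by a directed path `P u v` of `D` from `φ u` to `φ v`, of length at
least `1`, whose internal vertices are new and lie on no other of these paths. -/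
def ContainsSubdivision {W V : Type*} (H : Digraph W) (D : Digraph V) : Prop :=
  ∃ (φ : W → V) (P : W → W → List V),
    Function.Injective φ ∧
    (∀ u v, H.Adj u v → IsDipath D (φ u) (φ v) (P u v) ∧ 2 ≤ (P u v).length) ∧
    (∀ u v, H.Adj u v → ∀ w, φ w ∉ internalVertices (P u v)) ∧
    (∀ u v u' v', H.Adj u v → H.Adj u' v' → (u, v) ≠ (u', v') →
      ∀ z, z ∈ internalVertices (P u v) → z ∉ internalVertices (P u' v'))

/-- The directions of the successive edges met when going round a cycle with blocks of the given
lengths: the first block has direction `b`, and the directions of the blocks alternate. -/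
def blockDirections : Bool → List ℕ → List Bool
  | _, [] => []
  | b, m :: ks => List.replicate m b ++ blockDirections (!b) ks

/-- The oriented cycle `C(k₁, …, kₙ)` (for `n` even and positive `kᵢ`) on the vertices
`0, 1, …, k₁ + ⋯ + kₙ - 1`, taken modulo their number. The `j`-th edge joins `j` and `j + 1`; it is
the arc `(j, j + 1)` in the blocks of odd rank and `(j + 1, j)` in the blocks of even rank. -/
def blockCycle (ks : List ℕ) : Digraph (ZMod ks.sum) where
  Adj a b := ∃ j : ℕ,
    ((blockDirections true ks)[j]? = some true ∧ a = (j : ZMod ks.sum) ∧ b = (j : ZMod ks.sum) + 1) ∨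
    ((blockDirections true ks)[j]? = some false ∧ a = (j : ZMod ks.sum) + 1 ∧ b = (j : ZMod ks.sum))

/-- `T` is an out-tree with source `r` and vertex set `V`. -/
structure IsOutTree {V : Type*} (T : Digraph V) (r : V) : Prop where
  oriented : IsOriented T
  tree : T.toSimpleGraphInclusive.IsTree
  indegree_le_one : ∀ x y z, T.Adj x z → T.Adj y z → x = y
  source : ∀ x, ¬ T.Adj x r

/-- `T` is a spanning out-tree of `D` with source `r`. -/
def IsSpanningOutTree {V : Type*} (D T : Digraph V) (r : V) : Prop :=
  IsOutTree T r ∧ T ≤ D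

/-- The level of `x`: the number of vertices of the (unique) directed path of `T` from `r` to `x`. -/
noncomputable def level {V : Type*} (T : Digraph V) (r x : V) : ℕ :=
  sInf {n | ∃ p, IsDipath T r x p ∧ p.length = n}

/-- `y` is an ancestor of `x` in `T`: it lies on the directed path of `T` from `r` to `x`. -/
def IsAncestor {V : Type*} (T : Digraph V) (r y x : V) : Prop :=
  ∃ p, IsDipath T r x p ∧ y ∈ p

/-- `T` is a final out-tree of `D`: every backward arc of `D` goes to an ancestor. -/
def IsFinal {V : Type*} (D T : Digraph V) (r : V) : Prop :=
  ∀ x y, D.Adj x y → ¬ level T r x < level T r y → IsAncestor T r y x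

/-- The vertex class `V_i`: the union of the levels `i + α k` for `α ≥ 0`. -/
def levelClass {V : Type*} (T : Digraph V) (r : V) (k i : ℕ) : Set V :=
  {x | ∃ α : ℕ, level T r x = i + α * k}

/-- The subdigraph of `D` induced by a set of vertices. -/
def induced {V : Type*} (D : Digraph V) (S : Set V) : Digraph S where
  Adj x y := D.Adj x y

/-- The subdigraph `D_i` of `D` induced by `V_i`. -/
def classDigraph {V : Type*} (D T : Digraph V) (r : V) (k i : ℕ) :
    Digraph (levelClass T r k i) :=
  induced D (levelClass T r k i)

/-- The spanning subdigraph `D_i^1` of `D_i`: the arcs from an ancestor to a vertex of higher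
level. -/
def classDigraph₁ {V : Type*} (D T : Digraph V) (r : V) (k i : ℕ) :
    Digraph (levelClass T r k i) where
  Adj x y := (classDigraph D T r k i).Adj x y ∧
    level T r x < level T r y ∧ IsAncestor T r x y

/-- The spanning subdigraph `D_i^2` of `D_i`: the arcs to an ancestor of lower level. -/
def classDigraph₂ {V : Type*} (D T : Digraph V) (r : V) (k i : ℕ) :
    Digraph (levelClass T r k i) where
  Adj x y := (classDigraph D T r k i).Adj x y ∧
    level T r y < level T r x ∧ IsAncestor T r y x

/-- The spanning subdigraph `D_i^3` of `D_i`: the arcs of `D_i` that are neither in `D_i^1` nor in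
`D_i^2`. -/
def classDigraph₃ {V : Type*} (D T : Digraph V) (r : V) (k i : ℕ) :
    Digraph (levelClass T r k i) where
  Adj x y := (classDigraph D T r k i).Adj x y ∧
    ¬ ((classDigraph₁ D T r k i).Adj x y ∨ (classDigraph₂ D T r k i).Adj x y)

end SixBlocks

/-!
Order the vertices by a depth-first traversal of `T`, so that the descendants of a vertex form an
interval beginning with it. For an order and its mirror image, every arc of `D_i^3` is increasing
for one of the two, since its ends are not related in `T`.

A finite set `S` spanning more than `4 * #S` increasing arcs contains a nested antidirected path
`s₁ → t₁ ← s₂ → t₂ ← s₃ → t₃` with `s₁ < s₂ < s₃ < t₃ < t₂ < t₁`: four times over, discard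
alternately the first arc at each source and the last arc at each sink. Together with paths of `T`
it yields a subdivision of `C(k,1,1,1,1,1)`, whose long block is long because two levels of the
same class differ by at least `k`. If `s₂` is an ancestor of `t₃`, the long block is the path of `T`
from `s₂` to `t₃`, and the cycle is closed through the meet of `s₁` and `t₂`; otherwise the long
block is the path of `T` to `t₃` from the meet of `s₁` and `t₃`. The nesting keeps these paths
apart.

So `S` spans at most `8 * #S` arcs of `D_i^3`, which is therefore `16`-degenerate and
`17`-colourable.
-/

namespace SixBlocks

universe u

section RootPaths

variable {V : Type*} {D T : Digraph V} {r : V}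

theorem IsDipath.split {x y z : V} {s t : List V} (h : IsDipath D x y (s ++ z :: t)) :
    IsDipath D x z (s ++ [z]) ∧ IsDipath D z y (z :: t) := by
  have hinit : s ++ [z] <+: s ++ z :: t := ⟨t, by simp⟩
  have hsuffix : z :: t <:+ s ++ z :: t := List.suffix_append s _
  refine ⟨⟨h.chain.prefix hinit, h.nodup.sublist hinit.sublist, ?_, by simp⟩,
    ⟨h.chain.suffix hsuffix, h.nodup.sublist hsuffix.sublist, by simp, ?_⟩⟩
  · simpa [List.head?_append] using h.head
  · simpa only [List.getLast?_append_of_ne_nil s (List.cons_ne_nil z t)] using h.last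

theorem IsDipath.mono {x y : V} {p : List V} (h : IsDipath T x y p) (hle : T ≤ D) :
    IsDipath D x y p :=
  ⟨h.chain.imp hle, h.nodup, h.head, h.last⟩

theorem IsDipath.isChain_concat {x y z : V} {p : List V} (h : IsDipath D x y p)
    (hyz : D.Adj y z) : (p ++ [z]).IsChain D.Adj :=
  List.isChain_append.2 ⟨h.chain, by simp, by simpa [h.last]⟩

theorem IsDipath.concat {x y z : V} {p : List V} (h : IsDipath D x y p) (hyz : D.Adj y z)
    (hz : z ∉ p) : IsDipath D x z (p ++ [z]) where
  chain := h.isChain_concat hyz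
  nodup := List.nodup_append'.2 ⟨h.nodup, by simp, by simpa⟩
  head := by simp [List.head?_append, h.head]
  last := List.getLast?_concat

theorem IsOutTree.exists_isDipath (hT : IsOutTree T r) (x : V) : ∃ p, IsDipath T r x p := by
  have hconn := hT.tree.connected.preconnected r x
  rw [SimpleGraph.reachable_iff_reflTransGen] at hconn
  induction hconn with
  | refl => exact ⟨[r], by simp, by simp, by simp, by simp⟩
  | @tail y z _ hyz ih =>
    obtain ⟨p, hp⟩ := ih
    by_cases hz : z ∈ p
    · obtain ⟨s, t, rfl⟩ := List.append_of_mem hz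
      exact ⟨_, hp.split.1⟩
    rcases (SimpleGraph.fromRel_adj _ _ _).1 hyz |>.2 with hyz | hzy
    · exact ⟨_, hp.concat hyz hz⟩
    · obtain ⟨q, rfl⟩ := List.getLast?_eq_some_iff.1 hp.last
      rcases List.eq_nil_or_concat' q with rfl | ⟨q, a, rfl⟩
      · obtain rfl : y = r := by simpa using hp.head
        exact absurd hzy (hT.source z)
      · have hay : T.Adj a y := by simpa using hp.chain.suffix (l₁ := [a, y]) ⟨q, by simp⟩
        exact absurd (by simp [hT.indegree_le_one _ _ _ hzy hay]) hz

theorem IsDipath.exists_path (hD : IsOriented D) {x y : V} {p : List V} (h : IsDipath D x y p) :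
    ∃ w : D.toSimpleGraphInclusive.Path x y, w.1.support = p := by
  have hne : p ≠ [] := List.ne_nil_of_mem (List.mem_of_head? h.head)
  have hchain : p.IsChain D.toSimpleGraphInclusive.Adj := h.chain.imp fun a b hab =>
    (SimpleGraph.fromRel_adj _ _ _).2 ⟨fun e => hD a b hab (e ▸ e ▸ hab), .inl hab⟩
  have hsupport := SimpleGraph.Walk.support_ofSupport hne hchain
  obtain rfl : p.head hne = x := by simpa [List.head?_eq_some_head hne] using h.head
  obtain rfl : p.getLast hne = y := by simpa [List.getLast?_eq_some_getLast hne] using h.last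
  exact ⟨⟨.ofSupport p hne hchain, .mk' (hsupport.symm ▸ h.nodup)⟩, hsupport⟩

theorem IsOutTree.isDipath_unique (hT : IsOutTree T r) {x y : V} {p q : List V}
    (hp : IsDipath T x y p) (hq : IsDipath T x y q) : p = q := by
  obtain ⟨v, rfl⟩ := hp.exists_path hT.oriented
  obtain ⟨w, rfl⟩ := hq.exists_path hT.oriented
  rw [(hT.tree.isAcyclic.subsingleton_path x y).elim v w]

/-- The list of vertices of the directed path of `T` from `r` to `x`, and an unspecified list if `T`
has no such path. -/
noncomputable def rootPath (T : Digraph V) (r x : V) : List V :=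
  Classical.epsilon (IsDipath T r x)

theorem IsOutTree.isDipath_rootPath (hT : IsOutTree T r) (x : V) :
    IsDipath T r x (rootPath T r x) :=
  Classical.epsilon_spec (hT.exists_isDipath x)

theorem IsOutTree.eq_rootPath (hT : IsOutTree T r) {x : V} {p : List V} (hp : IsDipath T r x p) :
    p = rootPath T r x :=
  hT.isDipath_unique hp (hT.isDipath_rootPath x)

theorem IsOutTree.rootPath_injective (hT : IsOutTree T r) :
    Function.Injective (rootPath T r) := by
  intro x y hxy
  simpa [hxy, (hT.isDipath_rootPath y).last, eq_comm] using (hT.isDipath_rootPath x).last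

theorem IsOutTree.level_eq (hT : IsOutTree T r) (x : V) :
    level T r x = (rootPath T r x).length := by
  have hlengths : {n | ∃ p, IsDipath T r x p ∧ p.length = n} = {(rootPath T r x).length} :=
    Set.Subset.antisymm (by rintro _ ⟨p, hp, rfl⟩; rw [hT.eq_rootPath hp]; rfl)
      (Set.singleton_subset_iff.2 ⟨_, hT.isDipath_rootPath x, rfl⟩)
  rw [level, hlengths, csInf_singleton]

theorem IsOutTree.isAncestor_iff_mem (hT : IsOutTree T r) {a x : V} :
    IsAncestor T r a x ↔ a ∈ rootPath T r x :=
  ⟨fun ⟨_, hp, ha⟩ => hT.eq_rootPath hp ▸ ha, fun h => ⟨_, hT.isDipath_rootPath x, h⟩⟩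

theorem IsOutTree.isAncestor_iff_prefix_rootPath (hT : IsOutTree T r) {a x : V} :
    IsAncestor T r a x ↔ rootPath T r a <+: rootPath T r x := by
  rw [hT.isAncestor_iff_mem]
  refine ⟨fun h => ?_, fun h => h.subset (List.mem_of_getLast? (hT.isDipath_rootPath a).last)⟩
  obtain ⟨s, t, hst⟩ := List.append_of_mem h
  have hx := hT.isDipath_rootPath x
  rw [hst] at hx ⊢
  exact ⟨t, by simp [← hT.eq_rootPath hx.split.1]⟩

theorem IsOutTree.isAncestor_refl (hT : IsOutTree T r) (x : V) : IsAncestor T r x x :=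
  hT.isAncestor_iff_prefix_rootPath.2 List.prefix_rfl

theorem IsOutTree.isAncestor_trans (hT : IsOutTree T r) {a b x : V}
    (hab : IsAncestor T r a b) (hbx : IsAncestor T r b x) : IsAncestor T r a x :=
  hT.isAncestor_iff_prefix_rootPath.2
    ((hT.isAncestor_iff_prefix_rootPath.1 hab).trans (hT.isAncestor_iff_prefix_rootPath.1 hbx))

theorem IsOutTree.isAncestor_source (hT : IsOutTree T r) (x : V) : IsAncestor T r r x :=
  hT.isAncestor_iff_mem.2 (List.mem_of_head? (hT.isDipath_rootPath x).head)

theorem IsOutTree.level_le (hT : IsOutTree T r) {a x : V} (h : IsAncestor T r a x) :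
    level T r a ≤ level T r x := by
  simpa only [hT.level_eq] using (hT.isAncestor_iff_prefix_rootPath.1 h).length_le

theorem IsOutTree.eq_of_level_le (hT : IsOutTree T r) {a x : V} (h : IsAncestor T r a x)
    (hle : level T r x ≤ level T r a) : a = x := by
  simp only [hT.level_eq] at hle
  exact hT.rootPath_injective ((hT.isAncestor_iff_prefix_rootPath.1 h).eq_of_length_le hle)

theorem IsOutTree.isAncestor_total (hT : IsOutTree T r) {a b x : V} (ha : IsAncestor T r a x)
    (hb : IsAncestor T r b x) : IsAncestor T r a b ∨ IsAncestor T r b a := by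
  simp only [hT.isAncestor_iff_prefix_rootPath] at *
  exact List.prefix_or_prefix_of_prefix ha hb

theorem IsOutTree.exists_segment (hT : IsOutTree T r) {a x : V} (h : IsAncestor T r a x) :
    ∃ l, IsDipath T a x (a :: l) ∧ level T r a + l.length = level T r x ∧
      ∀ v ∈ l, IsAncestor T r a v ∧ IsAncestor T r v x ∧ v ≠ a := by
  obtain ⟨s, l, hsl⟩ := List.append_of_mem (hT.isAncestor_iff_mem.1 h)
  have hx := hT.isDipath_rootPath x
  rw [hsl] at hx
  refine ⟨l, hx.split.2, ?_, fun v hv => ⟨?_, hT.isAncestor_iff_mem.2 (by simp [hsl, hv]), ?_⟩⟩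
  · simp only [hT.level_eq, hsl, ← hT.eq_rootPath hx.split.1, List.length_append,
      List.length_cons, List.length_nil]
    omega
  · obtain ⟨l₁, l₂, rfl⟩ := List.append_of_mem hv
    rw [← List.cons_append, ← List.append_assoc] at hx
    exact ⟨_, hx.split.1, by simp⟩
  · rintro rfl
    exact (List.nodup_cons.1 hx.split.2.nodup).1 hv

theorem IsOutTree.exists_proper_segment (hT : IsOutTree T r) {a x : V} (h : IsAncestor T r a x)
    (hne : a ≠ x) : ∃ l, IsDipath T a x (a :: l ++ [x]) ∧
      level T r a + l.length + 1 = level T r x ∧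
      ∀ v ∈ l, IsAncestor T r a v ∧ IsAncestor T r v x ∧ v ≠ a ∧ v ≠ x := by
  obtain ⟨l, hl, hlen, hmem⟩ := hT.exists_segment h
  rcases List.eq_nil_or_concat' l with rfl | ⟨l, b, rfl⟩
  · exact absurd (by simpa using hl.last) hne
  obtain rfl : b = x := by
    have hlast := hl.last
    rwa [← List.cons_append, List.getLast?_concat, Option.some_inj] at hlast
  refine ⟨l, hl, by simpa [← add_assoc] using hlen, fun v hv => ?_⟩
  obtain ⟨hav, hvb, hva⟩ := hmem v (by simp [hv])
  refine ⟨hav, hvb, hva, ?_⟩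
  rintro rfl
  exact List.disjoint_of_nodup_append (List.nodup_cons.1 hl.nodup).2 hv (by simp)

theorem IsOutTree.exists_meet (hT : IsOutTree T r) (x y : V) :
    ∃ z, IsAncestor T r z x ∧ IsAncestor T r z y ∧
      ∀ v, IsAncestor T r v x → IsAncestor T r v y → IsAncestor T r v z := by
  have hfin : {v | IsAncestor T r v x ∧ IsAncestor T r v y}.Finite :=
    (List.finite_toSet (rootPath T r x)).subset fun v hv => hT.isAncestor_iff_mem.1 hv.1
  obtain ⟨z, ⟨hzx, hzy⟩, hmax⟩ := Set.exists_max_image _ (level T r) hfin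
    ⟨r, hT.isAncestor_source x, hT.isAncestor_source y⟩
  refine ⟨z, hzx, hzy, fun v hvx hvy => (hT.isAncestor_total hvx hzx).elim id fun hzv => ?_⟩
  exact hT.eq_of_level_le hzv (hmax v ⟨hvx, hvy⟩) ▸ hT.isAncestor_refl z

end RootPaths

section Subdivision

variable {V : Type*} {D : Digraph V}

theorem length_blockDirections (b : Bool) (ks : List ℕ) :
    (blockDirections b ks).length = ks.sum := by
  induction ks generalizing b with
  | nil => rfl
  | cons m ks ih => simp [blockDirections, ih]

theorem blockCycle_adj_iff {ks : List ℕ} (hks : 1 < ks.sum) {u v : ZMod ks.sum} :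
    (blockCycle ks).Adj u v ↔ ((blockDirections true ks)[u.val]? = some true ∧ v = u + 1) ∨
      ((blockDirections true ks)[v.val]? = some false ∧ u = v + 1) := by
  have : NeZero ks.sum := ⟨by omega⟩
  have hval {j : ℕ} {b : Bool} (hj : (blockDirections true ks)[j]? = some b) :
      (j : ZMod ks.sum).val = j := by
    obtain ⟨hj, -⟩ := List.getElem?_eq_some_iff.1 hj
    exact ZMod.val_natCast_of_lt (length_blockDirections true ks ▸ hj)
  constructor
  · rintro ⟨j, ⟨hj, rfl, rfl⟩ | ⟨hj, rfl, rfl⟩⟩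
    · exact .inl ⟨by rwa [hval hj], rfl⟩
    · exact .inr ⟨by rwa [hval hj], rfl⟩
  · rintro (⟨hj, rfl⟩ | ⟨hj, rfl⟩)
    · exact ⟨u.val, .inl ⟨hj, by simp⟩⟩
    · exact ⟨v.val, .inr ⟨hj, by simp⟩⟩

theorem containsSubdivision_blockCycle {ks : List ℕ} (hks : 2 < ks.sum) {φ : ZMod ks.sum → V}
    {I : ZMod ks.sum → List V} (hφ : Function.Injective φ) (hI : ∀ u, (I u).Nodup)
    (hφI : ∀ u v, φ u ∉ I v) (hdisj : ∀ u v, u ≠ v → (I u).Disjoint (I v))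
    (hforward : ∀ u, (blockDirections true ks)[u.val]? = some true →
      (φ u :: I u ++ [φ (u + 1)]).IsChain D.Adj)
    (hbackward : ∀ u, (blockDirections true ks)[u.val]? = some false →
      (φ (u + 1) :: I u ++ [φ u]).IsChain D.Adj) :
    ContainsSubdivision (blockCycle ks) D := by
  have : Fact (1 < ks.sum) := ⟨by omega⟩
  have : Fact (2 < ks.sum) := ⟨hks⟩
  -- The arc between `u` and `v` carries `I u` or `I v`, whichever end comes first on the cycle.
  let edge (u v : ZMod ks.sum) : ZMod ks.sum := if v = u + 1 then u else v
  have edge_forward (u) : edge u (u + 1) = u := if_pos rfl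
  have edge_backward (u) : edge (u + 1) u = u := by
    refine if_neg fun h => hks.not_ge (Nat.le_of_dvd two_pos ?_)
    exact (CharP.cast_eq_zero_iff (ZMod ks.sum) _ 2).1 (by linear_combination -h)
  have isDipath {u v w} (huv : u ≠ v) (h : (φ u :: I w ++ [φ v]).IsChain D.Adj) :
      IsDipath D (φ u) (φ v) (φ u :: I w ++ [φ v]) := by
    refine ⟨h, ?_, by simp, List.getLast?_concat⟩
    simp [hφI, hI, List.nodup_append', hφ.ne huv]
  refine ⟨φ, fun u v => φ u :: I (edge u v) ++ [φ v], hφ, fun u v huv => ⟨?_, by simp⟩, ?_, ?_⟩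
  · rcases (blockCycle_adj_iff (by omega)).1 huv with ⟨hu, rfl⟩ | ⟨hv, rfl⟩
    · exact isDipath (by simp) (by simpa only [edge_forward] using hforward u hu)
    · exact isDipath (by simp) (by simpa only [edge_backward] using hbackward v hv)
  · intro u v _ w
    simpa [internalVertices] using hφI w _
  · intro u v u' v' huv huv' hne z
    simp only [internalVertices, List.cons_append, List.tail_cons, List.dropLast_concat]
    refine fun hz hz' => hdisj _ _ ?_ hz hz'
    rcases (blockCycle_adj_iff (by omega)).1 huv with ⟨hu, rfl⟩ | ⟨hv, rfl⟩ <;>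
      rcases (blockCycle_adj_iff (by omega)).1 huv' with ⟨hu', rfl⟩ | ⟨hv', rfl⟩ <;>
      simp only [edge_forward, edge_backward] <;> rintro rfl <;> simp_all

theorem containsSubdivision_blockCycle_of_nodup {ks : List ℕ} (hks : 2 < ks.sum) {L : List V}
    {E : List (List V)} (hL : L.length = ks.sum) (hE : E.length = ks.sum)
    (hnodup : (L ++ E.flatten).Nodup)
    (hforward : ∀ j (hj : j < L.length), (blockDirections true ks)[j]? = some true →
      (L[j] :: E[j] ++ [L[(j + 1) % L.length]'(Nat.mod_lt _ (by omega))]).IsChain D.Adj)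
    (hbackward : ∀ j (hj : j < L.length), (blockDirections true ks)[j]? = some false →
      (L[(j + 1) % L.length]'(Nat.mod_lt _ (by omega)) :: E[j] ++ [L[j]]).IsChain D.Adj) :
    ContainsSubdivision (blockCycle ks) D := by
  have : NeZero ks.sum := ⟨by omega⟩
  obtain ⟨hLnodup, hEnodup, hLE⟩ := List.nodup_append'.1 hnodup
  obtain ⟨hEj, hEdisj⟩ := List.nodup_flatten.1 hEnodup
  have hL' (u : ZMod ks.sum) : u.val < L.length := u.val_lt.trans_eq hL.symm
  have hE' (u : ZMod ks.sum) : u.val < E.length := u.val_lt.trans_eq hE.symm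
  have hsucc (u : ZMod ks.sum) : L[(u + 1).val]'(hL' _) =
      L[(u.val + 1) % L.length]'(Nat.mod_lt _ (by omega)) := by
    simp only [ZMod.val_add, ZMod.val_one'' (show ks.sum ≠ 1 by omega), hL]
  refine containsSubdivision_blockCycle hks (φ := fun u => L[u.val]'(hL' u))
    (I := fun u => E[u.val]'(hE' u))
    (fun u v h => ZMod.val_injective _ (hLnodup.getElem_inj_iff.1 h))
    (fun u => hEj _ (List.getElem_mem _))
    (fun u v h => hLE (List.getElem_mem _) (List.mem_flatten_of_mem (List.getElem_mem _) h))
    (fun u v huv => ?_) (fun u hu => ?_) (fun u hu => ?_)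
  · rcases lt_or_gt_of_ne ((ZMod.val_injective _).ne huv) with h | h
    · exact List.pairwise_iff_getElem.1 hEdisj _ _ _ _ h
    · exact (List.pairwise_iff_getElem.1 hEdisj _ _ _ _ h).symm
  · simpa only [hsucc] using hforward u.val (hL' u) hu
  · simpa only [hsucc] using hbackward u.val (hL' u) hu

theorem getElem?_blockDirections_sixBlocks_eq_some_iff {n j : ℕ} {b : Bool} :
    (blockDirections true [n + 1, 1, 1, 1, 1, 1])[j]? = some b ↔
      if b then j ≤ n ∨ j = n + 2 ∨ j = n + 4 else j = n + 1 ∨ j = n + 3 ∨ j = n + 5 := by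
  have hdir : blockDirections true [n + 1, 1, 1, 1, 1, 1] =
      List.replicate (n + 1) true ++ [false, true, false, true, false] := by
    simp [blockDirections]
  rw [hdir]
  rcases lt_or_ge j (n + 1) with hj | hj
  · cases b <;> grind
  · obtain ⟨i, rfl⟩ := Nat.exists_eq_add_of_le hj
    rcases i with _ | _ | _ | _ | _ | i <;> cases b <;> grind

theorem containsSubdivision_of_hexagon {k : ℕ} (hk : 1 ≤ k) {x₀ x₁ x₂ x₃ x₄ x₅ : V}
    {I₀ I₁ I₂ I₃ I₄ I₅ : List V} (hlen : k ≤ I₀.length + 1)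
    (hnodup : (x₀ :: I₀ ++ [x₁, x₂, x₃, x₄, x₅] ++ (I₁ ++ I₂ ++ I₃ ++ I₄ ++ I₅)).Nodup)
    (h₀ : (x₀ :: I₀ ++ [x₁]).IsChain D.Adj) (h₁ : (x₂ :: I₁ ++ [x₁]).IsChain D.Adj)
    (h₂ : (x₂ :: I₂ ++ [x₃]).IsChain D.Adj) (h₃ : (x₄ :: I₃ ++ [x₃]).IsChain D.Adj)
    (h₄ : (x₄ :: I₄ ++ [x₅]).IsChain D.Adj) (h₅ : (x₀ :: I₅ ++ [x₅]).IsChain D.Adj) :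
    ContainsSubdivision (blockCycle [k, 1, 1, 1, 1, 1]) D := by
  classical
  -- `x₀ :: A` are the first `k` vertices of the cycle; the `k`-th arc is replaced by a path through
  -- `B`.
  obtain ⟨A, B, rfl, rfl⟩ : ∃ A B, I₀ = A ++ B ∧ k = A.length + 1 :=
    ⟨I₀.take (k - 1), I₀.drop (k - 1), by simp, by simp; omega⟩
  refine containsSubdivision_blockCycle_of_nodup
    (L := x₀ :: A ++ [x₁, x₂, x₃, x₄, x₅])
    (E := List.replicate A.length [] ++ [B, I₁, I₂, I₃, I₄, I₅])
    (by simp) (by simp) (by simp) ?_ ?_ ?_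
  · refine (List.Perm.nodup_iff (List.perm_iff_count.2 fun a => ?_)).1 hnodup
    simp only [List.cons_append, List.append_assoc, List.count_cons, List.count_append,
      List.flatten_append, List.flatten_replicate_nil, List.flatten_cons, List.count_nil,
      List.flatten_nil]
    omega
  · intro j hj hdj
    rcases getElem?_blockDirections_sixBlocks_eq_some_iff.1 hdj with h | rfl | rfl
    · rw [← List.cons_append, List.append_assoc] at h₀
      have hmod : (j + 1) % (x₀ :: A ++ [x₁, x₂, x₃, x₄, x₅]).length = j + 1 :=
        Nat.mod_eq_of_lt (by simp; omega)
      have hchain := h₀.drop j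
      rw [List.drop_eq_getElem_cons (by simp; omega), List.getElem_append_left (by simp; omega)]
        at hchain
      simp only [hmod, List.getElem_append_left (as := x₀ :: A) (by simp; omega : j < _)]
      rcases h.lt_or_eq with h | rfl
      · rw [List.drop_eq_getElem_cons (by simp; omega)] at hchain
        simpa [h, List.getElem_append_left] using hchain.prefix (List.prefix_append [_, _] _)
      · simpa [List.drop_append] using hchain
    · simpa [List.getElem_append_right, Nat.mod_eq_of_lt] using h₂
    · simpa [List.getElem_append_right, Nat.mod_eq_of_lt] using h₄
  · intro j hj hdj
    rcases getElem?_blockDirections_sixBlocks_eq_some_iff.1 hdj with rfl | rfl | rfl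
    · simpa [List.getElem_append_right, Nat.mod_eq_of_lt] using h₁
    · simpa [List.getElem_append_right, Nat.mod_eq_of_lt] using h₃
    · simpa [List.getElem_append_right] using h₅

end Subdivision

section Counting

open Finset

variable {V : Type*}

theorem exists_extend_coloring {G : SimpleGraph V} [DecidableRel G.Adj] [DecidableEq V] {d : ℕ}
    {S : Finset V} {v : V} (hdeg : #{w ∈ S | G.Adj v w} ≤ d) {f : V → Fin (d + 1)}
    (hf : ∀ u ∈ S.erase v, ∀ w ∈ S.erase v, G.Adj u w → f u ≠ f w) :
    ∃ g : V → Fin (d + 1), ∀ u ∈ S, ∀ w ∈ S, G.Adj u w → g u ≠ g w := by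
  obtain ⟨c, hc⟩ : ∃ c, c ∉ image f {w ∈ S | G.Adj v w} := by
    refine exists_mem_notMem_of_card_lt_card (t := univ) ?_ |>.imp fun c hc => hc.2
    simpa using card_image_le.trans_lt (Nat.lt_succ_of_le hdeg)
  have hcv {w} (hw : w ∈ S) (hvw : G.Adj v w) : c ≠ f w :=
    fun h => hc (mem_image.2 ⟨w, mem_filter.2 ⟨hw, hvw⟩, h.symm⟩)
  refine ⟨Function.update f v c, fun u hu w hw huw => ?_⟩
  rcases eq_or_ne u v with rfl | huv
  · simpa [huw.ne'] using hcv hw huw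
  rcases eq_or_ne w v with rfl | hwv
  · simpa [huv] using (hcv hu huw.symm).symm
  · simpa [huv, hwv] using hf u (mem_erase.2 ⟨huv, hu⟩) w (mem_erase.2 ⟨hwv, hw⟩) huw

theorem colorable_of_forall_exists_card_le {G : SimpleGraph V} [DecidableRel G.Adj] {d : ℕ}
    (h : ∀ S : Finset V, S.Nonempty → ∃ v ∈ S, #{w ∈ S | G.Adj v w} ≤ d) :
    G.Colorable (d + 1) := by
  classical
  have hfinite (S : Finset V) :
      ∃ f : V → Fin (d + 1), ∀ u ∈ S, ∀ w ∈ S, G.Adj u w → f u ≠ f w := by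
    induction S using Finset.strongInduction with
    | H S ih =>
      rcases S.eq_empty_or_nonempty with rfl | hS
      · exact ⟨fun _ => 0, by simp⟩
      obtain ⟨v, hv, hdeg⟩ := h S hS
      obtain ⟨f, hf⟩ := ih (S.erase v) (erase_ssubset hv)
      exact exists_extend_coloring hdeg hf
  choose f hf using hfinite
  obtain ⟨χ, hχ⟩ := Finset.rado_selection f
  refine ⟨SimpleGraph.Coloring.mk χ fun {u w} huw => ?_⟩
  obtain ⟨t, ht, hχt⟩ := hχ {u, w}
  have hu : u ∈ ({u, w} : Finset V) := by simp
  have hw : w ∈ ({u, w} : Finset V) := by simp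
  rw [hχt u hu, hχt w hw]
  exact hf t u (ht hu) w (ht hw) huw

theorem colorable_of_card_arcs_le {G : SimpleGraph V} {R : V → V → Prop} [DecidableRel R]
    (hR : ∀ v w, G.Adj v w → R v w ∨ R w v) {m : ℕ}
    (h : ∀ S : Finset V, #{p ∈ S ×ˢ S | R p.1 p.2} ≤ m * #S) : G.Colorable (2 * m + 1) := by
  classical
  refine colorable_of_forall_exists_card_le fun S hS => ?_
  have hdeg (v : V) : #{w ∈ S | G.Adj v w} ≤ #{w ∈ S | R v w} + #{w ∈ S | R w v} := by
    refine (card_le_card ?_).trans (card_union_le _ _)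
    rw [← filter_or]
    exact monotone_filter_right S fun w _ => hR v w
  have hout : ∑ v ∈ S, #{w ∈ S | R v w} = #{p ∈ S ×ˢ S | R p.1 p.2} := by
    simp only [card_filter, sum_product]
  have hin : ∑ v ∈ S, #{w ∈ S | R w v} = #{p ∈ S ×ˢ S | R p.1 p.2} := by
    simp only [card_filter, sum_product_right]
  refine exists_le_of_sum_le hS ?_
  calc ∑ v ∈ S, #{w ∈ S | G.Adj v w}
      ≤ ∑ v ∈ S, (#{w ∈ S | R v w} + #{w ∈ S | R w v}) := sum_le_sum fun v _ => hdeg v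
    _ = 2 * #{p ∈ S ×ˢ S | R p.1 p.2} := by rw [sum_add_distrib, hout, hin, two_mul]
    _ ≤ 2 * (m * #S) := by gcongr; exact h S
    _ = ∑ _v ∈ S, 2 * m := by rw [sum_const, smul_eq_mul]; ring

theorem card_le_card_filter_not_minimal_add {α γ β : Type*} [LinearOrder β] [DecidableEq γ]
    {A : Finset α} {S : Finset γ} {f : α → γ} {g : α → β} (hf : ∀ p ∈ A, f p ∈ S)
    (hfg : ∀ p ∈ A, ∀ q ∈ A, f p = f q → g p = g q → p = q) :
    #A ≤ #{p ∈ A | ∃ q ∈ A, f q = f p ∧ g q < g p} + #S := by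
  rw [← card_filter_add_card_filter_not (fun p => ∃ q ∈ A, f q = f p ∧ g q < g p)]
  gcongr
  refine card_le_card_of_injOn f (fun p hp => hf p (mem_filter.1 hp).1) fun p hp q hq hpq => ?_
  simp only [coe_filter, Set.mem_ofPred_eq, not_exists, not_and, not_lt] at hp hq
  exact hfg p hp.1 q hq.1 hpq (le_antisymm (hp.2 q hq.1 hpq.symm) (hq.2 p hp.1 hpq))

variable {β : Type*} [LinearOrder β]

/-- The antidirected path `s₁ → t₁ ← s₂ → t₂ ← s₃ → t₃` of the relation `R`, nested for the order
given by `key`: its sources increase, its sinks decrease and the sources precede the sinks. -/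
structure IsNestedAntipath (R : V → V → Prop) (key : V → β) (s₁ t₁ s₂ t₂ s₃ t₃ : V) : Prop where
  arc₁₁ : R s₁ t₁
  arc₂₁ : R s₂ t₁
  arc₂₂ : R s₂ t₂
  arc₃₂ : R s₃ t₂
  arc₃₃ : R s₃ t₃
  source₁_lt_source₂ : key s₁ < key s₂
  source₂_lt_source₃ : key s₂ < key s₃
  source₃_lt_sink₃ : key s₃ < key t₃
  sink₃_lt_sink₂ : key t₃ < key t₂
  sink₂_lt_sink₁ : key t₂ < key t₁

theorem exists_isNestedAntipath {key : V → β} (hkey : Function.Injective key)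
    {R : V → V → Prop} [DecidableRel R] {S : Finset V}
    (hcard : 4 * #S < #{p ∈ S ×ˢ S | R p.1 p.2 ∧ key p.1 < key p.2}) :
    ∃ s₁ t₁ s₂ t₂ s₃ t₃, IsNestedAntipath R key s₁ t₁ s₂ t₂ s₃ t₃ := by
  classical
  set A₀ := {p ∈ S ×ˢ S | R p.1 p.2 ∧ key p.1 < key p.2}
  -- A pruning loses at most one arc for each vertex of `S`, and each arc it keeps can be continued
  -- by an arc of the previous stage.
  let pruneSinks (A : Finset (V × V)) := {p ∈ A | ∃ q ∈ A, q.1 = p.1 ∧ key q.2 < key p.2}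
  let pruneSources (A : Finset (V × V)) := {p ∈ A | ∃ q ∈ A, q.2 = p.2 ∧ key p.1 < key q.1}
  have card_pruneSinks {A} (hA : A ⊆ A₀) : #A ≤ #(pruneSinks A) + #S :=
    card_le_card_filter_not_minimal_add (f := Prod.fst) (g := fun p => key p.2)
      (fun p hp => (mem_product.1 (mem_filter.1 (hA hp)).1).1)
      fun _ _ _ _ hfst hsnd => Prod.ext hfst (hkey hsnd)
  have card_pruneSources {A} (hA : A ⊆ A₀) : #A ≤ #(pruneSources A) + #S :=
    card_le_card_filter_not_minimal_add (f := Prod.snd) (g := fun p => OrderDual.toDual (key p.1))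
      (fun p hp => (mem_product.1 (mem_filter.1 (hA hp)).1).2)
      fun _ _ _ _ hsnd hfst => Prod.ext (hkey hfst) hsnd
  let A₁ := pruneSinks A₀
  let A₂ := pruneSources A₁
  let A₃ := pruneSinks A₂
  let A₄ := pruneSources A₃
  have h₁ : A₁ ⊆ A₀ := filter_subset _ _
  have h₂ : A₂ ⊆ A₀ := (filter_subset _ _).trans h₁
  have h₃ : A₃ ⊆ A₀ := (filter_subset _ _).trans h₂
  have hA₄ : 0 < #A₄ := by
    have : #A₀ ≤ #A₁ + #S := card_pruneSinks subset_rfl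
    have : #A₁ ≤ #A₂ + #S := card_pruneSources h₁
    have : #A₂ ≤ #A₃ + #S := card_pruneSinks h₂
    have : #A₃ ≤ #A₄ + #S := card_pruneSources h₃
    omega
  obtain ⟨⟨s₁, t₁⟩, h⟩ := card_pos.1 hA₄
  obtain ⟨h₁₁, ⟨s₂, _⟩, h₂₁, rfl, hs⟩ := mem_filter.1 h
  obtain ⟨h₂₁, ⟨_, t₂⟩, h₂₂, rfl, ht⟩ := mem_filter.1 h₂₁
  obtain ⟨h₂₂, ⟨s₃, _⟩, h₃₂, rfl, hs'⟩ := mem_filter.1 h₂₂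
  obtain ⟨h₃₂, ⟨_, t₃⟩, h₃₃, rfl, ht'⟩ := mem_filter.1 h₃₂
  have arc {p} (hp : p ∈ A₀) : R p.1 p.2 ∧ key p.1 < key p.2 := (mem_filter.1 hp).2
  exact ⟨s₁, _, _, _, _, t₃, (arc (h₃ h₁₁)).1, (arc (h₂ h₂₁)).1, (arc (h₁ h₂₂)).1,
    (arc h₃₂).1, (arc h₃₃).1, hs, hs', (arc h₃₃).2, ht', ht⟩

end Counting

section Lists

variable {α : Type*} [LinearOrder α]

theorem prefix_of_le_of_le {a v w : List α} (haw : a <+: w) (hav : a ≤ v) (hvw : v ≤ w) :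
    a <+: v := by
  induction a generalizing v w with
  | nil => exact List.nil_prefix
  | cons x a ih =>
    obtain ⟨t, rfl⟩ := haw
    cases v with
    | nil => exact absurd hav (not_le_of_gt (List.nil_lt_cons _ _))
    | cons y v =>
      simp only [List.cons_append, ← not_lt, List.cons_lt_cons_iff, not_or, not_and] at hav hvw
      obtain rfl : x = y := le_antisymm (not_lt.1 hav.1) (not_lt.1 hvw.1)
      rw [List.prefix_cons_inj]
      exact ih ⟨t, rfl⟩ (not_lt.1 (hav.2 rfl)) (not_lt.1 (hvw.2 rfl))

theorem lt_or_map_toDual_lt {x y : List α} (hxy : ¬ x <+: y) (hyx : ¬ y <+: x) :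
    x < y ∨ x.map OrderDual.toDual < y.map OrderDual.toDual := by
  induction x generalizing y with
  | nil => exact absurd List.nil_prefix hxy
  | cons a x ih =>
    cases y with
    | nil => exact absurd List.nil_prefix hyx
    | cons b y =>
      simp only [List.map_cons, List.cons_lt_cons_iff, OrderDual.toDual_lt_toDual]
      rcases lt_trichotomy a b with h | rfl | h
      · exact .inl (.inl h)
      · rw [List.prefix_cons_inj] at hxy hyx
        rcases ih hxy hyx with h | h
        · exact .inl (.inr ⟨rfl, h⟩)
        · exact .inr (.inr ⟨rfl, h⟩)
      · exact .inr (.inl h)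

end Lists

section Cycles

variable {V : Type*} {D T : Digraph V} {r : V}

/-- A linear order, given by an injection `key`, in which the descendants of each vertex of `T` form
an interval that begins with this vertex, as in a depth-first traversal of `T`. -/
structure IsPreorderKey {β : Type*} [LinearOrder β] (T : Digraph V) (r : V) (key : V → β) :
    Prop where
  injective : Function.Injective key
  mono : ∀ {a x}, IsAncestor T r a x → key a ≤ key x
  interval : ∀ {a v x}, IsAncestor T r a x → key a ≤ key v → key v ≤ key x → IsAncestor T r a v

theorem IsOutTree.isPreorderKey (hT : IsOutTree T r) {α : Type*} [LinearOrder α] {f : V → α}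
    (hf : Function.Injective f) : IsPreorderKey T r fun x => (rootPath T r x).map f := by
  have hanc {a x} :
      IsAncestor T r a x ↔ (rootPath T r a).map f <+: (rootPath T r x).map f := by
    rw [hT.isAncestor_iff_prefix_rootPath, List.prefix_map_iff_of_injective hf]
  exact ⟨(List.map_injective_iff.2 hf).comp hT.rootPath_injective,
    fun h => not_lt.1 (hanc.1 h).le,
    fun h hav hvx => hanc.2 (prefix_of_le_of_le (hanc.1 h) hav hvx)⟩

theorem IsOutTree.exists_isPreorderKey_pair {V : Type u} {T : Digraph V} {r : V}
    (hT : IsOutTree T r) :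
    ∃ (β β' : Type u) (_ : LinearOrder β) (_ : LinearOrder β') (key : V → β) (key' : V → β'),
      IsPreorderKey T r key ∧ IsPreorderKey T r key' ∧
      ∀ {x y}, ¬ IsAncestor T r x y → ¬ IsAncestor T r y x → key x < key y ∨ key' x < key' y := by
  obtain ⟨_, -⟩ := exists_wellFoundedLT V
  refine ⟨List V, List Vᵒᵈ, inferInstance, inferInstance, _, _,
    hT.isPreorderKey Function.injective_id, hT.isPreorderKey OrderDual.toDual.injective,
    fun hxy hyx => ?_⟩
  rw [hT.isAncestor_iff_prefix_rootPath] at hxy hyx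
  simpa only [List.map_id] using lt_or_map_toDual_lt hxy hyx

/-- The arcs of `D` that join two vertices of the same class modulo `k`, go to a higher level and
do not follow a path of `T`. When `T` is final, these are, up to loops, the arcs of the digraphs
`D_i^3`, all `i` together. -/
def crossDigraph (D T : Digraph V) (r : V) (k : ℕ) : Digraph V where
  Adj x y := D.Adj x y ∧ ¬ IsAncestor T r x y ∧ level T r x < level T r y ∧
    level T r x ≡ level T r y [MOD k]

variable {β : Type*} [LinearOrder β] {key : V → β} {k : ℕ} {s₁ t₁ s₂ t₂ s₃ t₃ : V}

theorem IsPreorderKey.lt (hkey : IsPreorderKey T r key) {a x : V} (h : IsAncestor T r a x)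
    (hne : a ≠ x) : key a < key x :=
  (hkey.mono h).lt_of_ne (hkey.injective.ne hne)

theorem IsPreorderKey.exists_proper_segment (hkey : IsPreorderKey T r key)
    (hT : IsSpanningOutTree D T r) {a x : V} (h : IsAncestor T r a x) (hne : a ≠ x) :
    ∃ l, (a :: l ++ [x]).IsChain D.Adj ∧ l.Nodup ∧ level T r a + l.length + 1 = level T r x ∧
      ∀ v ∈ l, IsAncestor T r a v ∧ IsAncestor T r v x ∧ key a < key v ∧ key v < key x := by
  obtain ⟨l, hl, hlen, hmem⟩ := hT.1.exists_proper_segment h hne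
  refine ⟨l, hl.chain.imp hT.2, ?_, hlen, fun v hv => ?_⟩
  · exact (List.nodup_cons.1 (List.nodup_append'.1 hl.nodup).1).2
  · obtain ⟨hav, hvx, hva, hvx'⟩ := hmem v hv
    exact ⟨hav, hvx, hkey.lt hav hva.symm, hkey.lt hvx hvx'⟩

theorem IsPreorderKey.exists_segment_concat (hkey : IsPreorderKey T r key)
    (hT : IsSpanningOutTree D T r) {a x y : V} (h : IsAncestor T r a x) (hxy : D.Adj x y) :
    ∃ l, (a :: l ++ [y]).IsChain D.Adj ∧ l.Nodup ∧
      ∀ v ∈ l, IsAncestor T r a v ∧ IsAncestor T r v x ∧ key a < key v ∧ key v ≤ key x := by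
  obtain ⟨l, hl, -, hmem⟩ := hT.1.exists_segment h
  refine ⟨l, (hl.mono hT.2).isChain_concat hxy, (List.nodup_cons.1 hl.nodup).2, fun v hv => ?_⟩
  obtain ⟨hav, hvx, hva⟩ := hmem v hv
  exact ⟨hav, hvx, hkey.lt hav hva.symm, hkey.mono hvx⟩

theorem IsNestedAntipath.containsSubdivision_of_isAncestor (hT : IsSpanningOutTree D T r)
    (hkey : IsPreorderKey T r key) (hk : 1 ≤ k)
    (h : IsNestedAntipath (crossDigraph D T r k).Adj key s₁ t₁ s₂ t₂ s₃ t₃)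
    (hanc : IsAncestor T r s₂ t₃) : ContainsSubdivision (blockCycle [k, 1, 1, 1, 1, 1]) D := by
  obtain ⟨⟨a₁₁, -, -, -⟩, ⟨a₂₁, -, -, -⟩, ⟨-, n₂₂, -, c₂₂⟩, ⟨a₃₂, n₃₂, -, c₃₂⟩, ⟨a₃₃, n₃₃, -, c₃₃⟩,
    k₁₂, k₂₃, k₃₃, k₃₂, k₂₁⟩ := h
  obtain ⟨z, hz₁, hz₂, hmeet⟩ := hT.1.exists_meet s₁ t₂
  have kz := hkey.mono hz₁
  obtain ⟨l, hl, hlnodup, hlen, hlmem⟩ := hkey.exists_proper_segment hT hanc (by rintro rfl; order)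
  obtain ⟨m, hm, hmnodup, -, hmmem⟩ := hkey.exists_proper_segment hT hz₂ (by rintro rfl; order)
  obtain ⟨q, hq, hqnodup, hqmem⟩ := hkey.exists_segment_concat hT hz₁ a₁₁
  have hlevel : level T r s₂ + k ≤ level T r t₃ :=
    ((c₂₂.trans c₃₂.symm).trans c₃₃).add_le_of_lt (by omega)
  have hs₃l : s₃ ∉ l := fun h => n₃₃ (hlmem s₃ h).2.1
  have hs₃m : s₃ ∉ m := fun h => n₃₂ (hmmem s₃ h).2.1
  have hanc_m {v} (hv : v ∈ m) : ¬ IsAncestor T r s₂ v := fun h =>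
    n₂₂ (hT.1.isAncestor_trans h (hmmem v hv).2.1)
  have hs₂m : s₂ ∉ m := fun h => hanc_m h (hT.1.isAncestor_refl s₂)
  have ht₃m : t₃ ∉ m := fun h => hanc_m h hanc
  have hlm : ∀ v ∈ l, v ∉ m := fun v hv hv' => hanc_m hv' (hlmem v hv).1
  have hmq : ∀ v ∈ m, v ∉ q := fun v hv hv' => (hmmem v hv).2.2.1.not_ge
    (hkey.mono (hmeet v (hqmem v hv').2.1 (hmmem v hv).2.1))
  refine containsSubdivision_of_hexagon hk (x₀ := s₂) (x₁ := t₃) (x₂ := s₃) (x₃ := t₂) (x₄ := z)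
    (x₅ := t₁) (I₀ := l) (I₁ := []) (I₂ := []) (I₃ := m) (I₄ := q) (I₅ := []) (by omega) ?_
    hl (by simpa) (by simpa) hm hq (by simpa)
  simp only [List.nodup_append', List.nodup_cons, List.cons_append, List.nil_append,
    List.append_nil, List.disjoint_left, List.mem_append, List.mem_cons,
    not_or, List.append_assoc]
  grind (splits := 40)

theorem IsNestedAntipath.containsSubdivision_of_not_isAncestor (hT : IsSpanningOutTree D T r)
    (hkey : IsPreorderKey T r key) (hk : 1 ≤ k)
    (h : IsNestedAntipath (crossDigraph D T r k).Adj key s₁ t₁ s₂ t₂ s₃ t₃)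
    (hanc : ¬ IsAncestor T r s₂ t₃) : ContainsSubdivision (blockCycle [k, 1, 1, 1, 1, 1]) D := by
  obtain ⟨⟨a₁₁, -, -, -⟩, ⟨a₂₁, -, -, -⟩, ⟨a₂₂, -, -, -⟩, ⟨a₃₂, -, -, -⟩, ⟨a₃₃, n₃₃, l₃₃, c₃₃⟩,
    k₁₂, k₂₃, k₃₃, k₃₂, k₂₁⟩ := h
  obtain ⟨z, hz₁, hz₃, hmeet⟩ := hT.1.exists_meet s₁ t₃
  have kz := hkey.mono hz₁
  obtain ⟨l, hl, hlnodup, hlen, hlmem⟩ := hkey.exists_proper_segment hT hz₃ (by rintro rfl; order)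
  obtain ⟨q, hq, hqnodup, hqmem⟩ := hkey.exists_segment_concat hT hz₁ a₁₁
  have hzs₃ : level T r z ≤ level T r s₃ :=
    hT.1.level_le (hkey.interval hz₃ (by order) (by order))
  have hlevel : level T r s₃ + k ≤ level T r t₃ := c₃₃.add_le_of_lt l₃₃
  have hs₂l : s₂ ∉ l := fun h => hanc (hlmem s₂ h).2.1
  have hs₃l : s₃ ∉ l := fun h => n₃₃ (hlmem s₃ h).2.1
  have hlq : ∀ v ∈ l, v ∉ q := fun v hv hv' => (hlmem v hv).2.2.1.not_ge
    (hkey.mono (hmeet v (hqmem v hv').2.1 (hlmem v hv).2.1))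
  refine containsSubdivision_of_hexagon hk (x₀ := z) (x₁ := t₃) (x₂ := s₃) (x₃ := t₂) (x₄ := s₂)
    (x₅ := t₁) (I₀ := l) (I₁ := []) (I₂ := []) (I₃ := []) (I₄ := []) (I₅ := q) (by omega) ?_
    hl (by simpa) (by simpa) (by simpa) (by simpa) hq
  simp only [List.nodup_append', List.nodup_cons, List.cons_append, List.nil_append,
    List.append_nil, List.disjoint_left, List.mem_append, List.mem_cons,
    not_or, List.append_assoc]
  grind (splits := 40)

theorem IsNestedAntipath.containsSubdivision (hT : IsSpanningOutTree D T r)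
    (hkey : IsPreorderKey T r key) (hk : 1 ≤ k)
    (h : IsNestedAntipath (crossDigraph D T r k).Adj key s₁ t₁ s₂ t₂ s₃ t₃) :
    ContainsSubdivision (blockCycle [k, 1, 1, 1, 1, 1]) D :=
  (em (IsAncestor T r s₂ t₃)).elim (h.containsSubdivision_of_isAncestor hT hkey hk)
    (h.containsSubdivision_of_not_isAncestor hT hkey hk)

end Cycles

section Coloring

open Finset

variable {V : Type*} {D T : Digraph V} {r : V} {k : ℕ}

theorem card_increasing_arcs_crossDigraph_le [DecidableRel (crossDigraph D T r k).Adj] (hk : 1 ≤ k)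
    (hfree : ¬ ContainsSubdivision (blockCycle [k, 1, 1, 1, 1, 1]) D)
    (hT : IsSpanningOutTree D T r) {β : Type*} [LinearOrder β] {key : V → β}
    (hkey : IsPreorderKey T r key) (S : Finset V) :
    #{p ∈ S ×ˢ S | (crossDigraph D T r k).Adj p.1 p.2 ∧ key p.1 < key p.2} ≤ 4 * #S := by
  by_contra! hcard
  obtain ⟨_, _, _, _, _, _, h⟩ := exists_isNestedAntipath hkey.injective hcard
  exact hfree (h.containsSubdivision hT hkey hk)

theorem card_arcs_crossDigraph_le [DecidableRel (crossDigraph D T r k).Adj] (hk : 1 ≤ k)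
    (hfree : ¬ ContainsSubdivision (blockCycle [k, 1, 1, 1, 1, 1]) D)
    (hT : IsSpanningOutTree D T r) (S : Finset V) :
    #{p ∈ S ×ˢ S | (crossDigraph D T r k).Adj p.1 p.2} ≤ 8 * #S := by
  classical
  obtain ⟨β, β', _, _, key, key', hkey, hkey', hlt⟩ := hT.1.exists_isPreorderKey_pair
  have hincreasing {x y} (h : (crossDigraph D T r k).Adj x y) : key x < key y ∨ key' x < key' y :=
    hlt h.2.1 fun hyx => (hT.1.level_le hyx).not_gt h.2.2.1
  calc #{p ∈ S ×ˢ S | (crossDigraph D T r k).Adj p.1 p.2}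
      ≤ #{p ∈ S ×ˢ S | (crossDigraph D T r k).Adj p.1 p.2 ∧ key p.1 < key p.2} +
          #{p ∈ S ×ˢ S | (crossDigraph D T r k).Adj p.1 p.2 ∧ key' p.1 < key' p.2} := by
        refine (card_le_card ?_).trans (card_union_le _ _)
        rw [← filter_or]
        exact monotone_filter_right _ fun p _ h => (hincreasing h).imp (.intro h) (.intro h)
    _ ≤ 4 * #S + 4 * #S := add_le_add
        (card_increasing_arcs_crossDigraph_le hk hfree hT hkey S)
        (card_increasing_arcs_crossDigraph_le hk hfree hT hkey' S)
    _ = 8 * #S := by ring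

theorem colorable_crossDigraph (hk : 1 ≤ k)
    (hfree : ¬ ContainsSubdivision (blockCycle [k, 1, 1, 1, 1, 1]) D)
    (hT : IsSpanningOutTree D T r) :
    (crossDigraph D T r k).toSimpleGraphInclusive.Colorable 17 := by
  classical
  exact colorable_of_card_arcs_le (m := 8)
    (fun _ _ h => ((SimpleGraph.fromRel_adj _ _ _).1 h).2) (card_arcs_crossDigraph_le hk hfree hT)

theorem crossDigraph_adj_of_classDigraph₃_adj (hT : IsOutTree T r) (hfinal : IsFinal D T r) {i : ℕ}
    {x y : levelClass T r k i} (hne : x ≠ y) (h : (classDigraph₃ D T r k i).Adj x y) :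
    (crossDigraph D T r k).Adj x y := by
  obtain ⟨hxy, hnot⟩ := h
  obtain ⟨hforward, hbackward⟩ := not_or.1 hnot
  have hlt : level T r x < level T r y := by
    by_contra hle
    have hyx := hfinal x y hxy hle
    refine hbackward ⟨hxy, (hT.level_le hyx).lt_of_ne fun heq => hne ?_, hyx⟩
    exact Subtype.ext (hT.eq_of_level_le hyx heq.ge).symm
  refine ⟨hxy, fun hanc => hforward ⟨hxy, hlt, hanc⟩, hlt, ?_⟩
  obtain ⟨a, hx⟩ := x.2
  obtain ⟨b, hy⟩ := y.2
  simp [hx, hy, Nat.ModEq]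

end Coloring

end SixBlocks

theorem propositionp3_general {V : Type*} {k : ℕ} (hk : 1 ≤ k) {D T : Digraph V} {r : V}
    (hfree : ¬ SixBlocks.ContainsSubdivision (SixBlocks.blockCycle [k, 1, 1, 1, 1, 1]) D)
    (hT : SixBlocks.IsSpanningOutTree D T r) (hfinal : SixBlocks.IsFinal D T r) (i : ℕ) :
    SixBlocks.chi (SixBlocks.classDigraph₃ D T r k i) ≤ 17 := by
  let toCross : (SixBlocks.classDigraph₃ D T r k i).toSimpleGraphInclusive →g
      (SixBlocks.crossDigraph D T r k).toSimpleGraphInclusive :=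
    ⟨Subtype.val, fun {x y} h => by
      obtain ⟨hne, hadj⟩ := (SimpleGraph.fromRel_adj _ _ _).1 h
      exact (SimpleGraph.fromRel_adj _ _ _).2 ⟨Subtype.coe_ne_coe.2 hne, hadj.imp
        (SixBlocks.crossDigraph_adj_of_classDigraph₃_adj hT.1 hfinal hne)
        (SixBlocks.crossDigraph_adj_of_classDigraph₃_adj hT.1 hfinal hne.symm)⟩⟩
  exact ((SixBlocks.colorable_crossDigraph hk hfree hT).of_hom toCross).chromaticNumber_le

theorem propositionp3 {V : Type*} [Finite V] (k : ℕ) (D T : Digraph V) (r : V)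
    (hD : SixBlocks.IsOriented D)
    (hfree : ¬ SixBlocks.ContainsSubdivision (SixBlocks.blockCycle [k, 1, 1, 1, 1, 1]) D)
    (hT : SixBlocks.IsSpanningOutTree D T r)
    (hfinal : SixBlocks.IsFinal D T r) :
    ∀ i : ℕ, 1 ≤ i → i ≤ k → SixBlocks.chi (SixBlocks.classDigraph₃ D T r k i) ≤ 24 :=
  fun i hi hik => (propositionp3_general (hi.trans hik) hfree hT hfinal i).trans (by norm_num)
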